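/- **Setting.** Let $\Gamma$ be a totally ordered abelian group, $F$ a field with a valuation $\nu:F^\times\to\Gamma$, ring of integers $\mathcal O_F$, and residue field $k=\overline F$, where $k$ is a local field (a non-discrete locally compact field) with residue map $\mathcal O_F\to k$, $x\mapsto\overline x$. Suppose that $\nu$ is split by a homomorphism $t:\Gamma\to F^\times$, $\nu\circ t=\mathrm{id}_\Gamma$. Let $\mathbb C(\Gamma)$ be the field of fractions of the complex group algebra of $\Gamma$, with basis elements of the group algebra written $X^\gamma$. Fix a Haar measure on $k$ and the product measure on $k^n$; let $|\cdot|$ be the absolute value on $k$ given by the module of multiplication with respect to Haar measure, and for $\alpha\in F^\times$ set $|\alpha|=\bigl|\overline{\alpha\,t(-\nu(\alpha))}\bigr|\,X^{\nu(\alpha)}\in\mathbb C(\Gamma)$. For $g:k^n\to\mathbb C$, $a\in F^n$, $\gamma\in\Gamma^n$, the lift $g^{a,\gamma}:F^n\to\mathbb C$ is $$g^{a,\gamma}(x)=g\bigl(\overline{(x_1-a_1)t(-\gamma_1)},\dots,\overline{(x_n-a_n)t(-\gamma_n)}\bigr)$$ if $x_i\in a_i+t(\gamma_i)\mathcal O_F$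 for all $i$, and $g^{a,\gamma}(x)=0$ otherwise. A function $F\to\mathbb C(\Gamma)$ is *integrable* if it lies in the $\mathbb C(\Gamma)$-span of the functions $g^{a,\gamma}X^{\delta}$ with $g$ Haar integrable on $k$, $a\in F$, $\gamma,\delta\in\Gamma$; the integral $\int^F$ is the unique $\mathbb C(\Gamma)$-linear functional on the integrable functions with $\int^F g^{a,\gamma}(x)\,dx=\int_k g(u)\,du\;X^{\gamma}$. *Fubini functions on $F^n$* ($n\ge1$) and their *repeated integral* $\int^{F^n}$ are defined inductively. For $n=1$, Fubini means integrable and $\int^{F^1}=\int^F$. For $n>1$, $f:F^n\to\mathbb C(\Gamma)$ is Fubini if for each $1\le r\le n$ and all values of the other variables the function $x_r\mapsto f(x_1,\dots,x_n)$ is integrable on $F$, the function $(x_1,\dots,x_{r-1},x_{r+1},\dots,x_n)\mapsto\int^F f(x_1,\dots,x_n)\,dx_r$ is Fubini on $F^{n-1}$, and the repeated integral of the latter does not depend on $r$; this common value is $\int^{F^n}f(x)\,dx$. A function $g:k^n\to\mathbb C$ is *Fubini* if it is Haar integrable on $k^n$ and (for $n>1$) for each $r$ and all values of the other variables $u_r\mapsto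 g(u_1,\dots,u_n)$ is Haar integrable on $k$, and $(u_1,\dots,u_{r-1},u_{r+1},\dots,u_n)\mapsto\int_k g(u_1,\dots,u_n)\,du_r$ is Fubini on $k^{n-1}$. It is *GL-Fubini* if $g\circ\tau$ is Fubini for every $\tau\in\mathrm{GL}_n(k)$. Let $\mathcal L(F^n,\mathrm{GL}_n)$ be the $\mathbb C(\Gamma)$-space of functions $F^n\to\mathbb C(\Gamma)$ spanned by the functions $g^{a,\gamma}\circ\tau$ with $g$ GL-Fubini on $k^n$, $\tau\in\mathrm{GL}_n(F)$, $a\in F^n$, $\gamma\in\Gamma^n$. **Theorem.** Every function in $\mathcal L(F^n,\mathrm{GL}_n)$ is Fubini on $F^n$. If $f\in\mathcal L(F^n,\mathrm{GL}_n)$, $a\in F^n$ and $\tau\in\mathrm{GL}_n(F)$, then the functions $x\mapsto f(x+a)$ and $x\mapsto f(\tau x)$ belong to $\mathcal L(F^n,\mathrm{GL}_n)$, and $$\int^{F^n}f(x+a)\,dx=\int^{F^n}f(x)\,dx,\qquad \int^{F^n}f(\tau x)\,dx=|\det\tau|^{-1}\int^{F^n}f(x)\,dx.$$ -/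

import Mathlib

open MeasureTheory

noncomputable section

namespace ResidueIntegration

/-- `ℂ(Γ)`: the field of fractions of the complex group algebra of `Γ`. -/
abbrev CC (Γ : Type*) [AddCommGroup Γ] [LinearOrder Γ] [IsOrderedAddMonoid Γ] : Type _ :=
  FractionRing (AddMonoidAlgebra ℂ Γ)

/-- The element `X^γ` of `ℂ(Γ)`. -/
def X {Γ : Type*} [AddCommGroup Γ] [LinearOrder Γ] [IsOrderedAddMonoid Γ] (γ : Γ) : CC Γ :=
  algebraMap (AddMonoidAlgebra ℂ Γ) (CC Γ) (AddMonoidAlgebra.single γ 1)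

/-- The inclusion `ℂ → ℂ(Γ)`. -/
def ofC (Γ : Type*) [AddCommGroup Γ] [LinearOrder Γ] [IsOrderedAddMonoid Γ] : ℂ →+* CC Γ :=
  algebraMap ℂ (CC Γ)

/-- A field `F` with a valuation `ν : Fˣ → Γ` (extended by `ν 0 = ⊤`), a splitting `t` of `ν`, and
the residue map `ρ` from the ring of integers `{x | 0 ≤ ν x}` onto the residue field `k`.
Since the ring of integers is local and `k` is a field, surjectivity of `ρ` says exactly that `ρ`
identifies `k` with the quotient of the ring of integers by its maximal ideal. -/
structure SplitValuedField (F Γ k : Type*) [Field F] [AddCommGroup Γ] [LinearOrder Γ]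
    [IsOrderedAddMonoid Γ] [Field k] where
  /-- the valuation -/
  ν : AddValuation F (WithTop Γ)
  /-- the splitting of the valuation -/
  t : Multiplicative Γ →* Fˣ
  ν_t : ∀ γ : Γ, ν (t (Multiplicative.ofAdd γ) : F) = (γ : WithTop Γ)
  /-- the residue map -/
  ρ : (AddValuation.toValuation ν).valuationSubring →+* k
  ρ_surjective : Function.Surjective ρ

/-- The absolute value of a local field, as the module of multiplication by `u` :
`μ (u • s) = modulus u * μ s` for every Haar measure `μ`; also `modulus 0 = 0`. -/
def modulus {k : Type*} [NontriviallyNormedField k] [LocallyCompactSpace k] (u : k) : ℝ :=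
  open Classical in
  if h : u = 0 then 0 else (distribHaarChar k (Units.mk0 u h) : ℝ)

namespace SplitValuedField

variable {F Γ k : Type*} [Field F] [AddCommGroup Γ] [LinearOrder Γ] [IsOrderedAddMonoid Γ]

section Algebra

variable [Field k] (D : SplitValuedField F Γ k)

/-- The ring of integers of `F`. -/
abbrev O : ValuationSubring F := (AddValuation.toValuation D.ν).valuationSubring

/-- `t γ` as an element of `F`. -/
def tF (γ : Γ) : F := (D.t (Multiplicative.ofAdd γ) : F)

/-- The residue of an element of the ring of integers (and `0` elsewhere). -/
def res (x : F) : k :=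
  open Classical in
  if h : x ∈ D.O then D.ρ ⟨x, h⟩ else 0

/-- The value in `Γ` of a nonzero element. -/
def val (α : Fˣ) : Γ := (D.ν (α : F)).untopD 0

/-- The lift `g^{a,γ}` to `F` of a function `g` on the residue field.
The condition `(x - a) t(-γ) ∈ O` says that `x ∈ a + t(γ) O`. -/
def lift {A : Type*} [Zero A] (g : k → A) (a : F) (γ : Γ) (x : F) : A :=
  open Classical in
  if (x - a) * D.tF (-γ) ∈ D.O then g (D.res ((x - a) * D.tF (-γ))) else 0

/-- The lift `g^{a,γ}` to `F^n` of a function `g` on `k^n`. -/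
def liftN {A : Type*} [Zero A] {n : ℕ} (g : (Fin n → k) → A) (a : Fin n → F) (γ : Fin n → Γ)
    (x : Fin n → F) : A :=
  open Classical in
  if ∀ i, (x i - a i) * D.tF (-γ i) ∈ D.O then
    g (fun i => D.res ((x i - a i) * D.tF (-γ i)))
  else 0

variable {D}

theorem mem_O {x : F} : x ∈ D.O ↔ 0 ≤ D.ν x := Iff.rfl

theorem tF_add (γ δ : Γ) : D.tF (γ + δ) = D.tF γ * D.tF δ := by
  simp [tF]

theorem ν_tF (γ : Γ) : D.ν (D.tF γ) = (γ : WithTop Γ) := D.ν_t γ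

theorem tF_mul_neg (γ : Γ) : D.tF γ * D.tF (-γ) = 1 := by
  simp [tF]

theorem res_add {x y : F} (hx : x ∈ D.O) (hy : y ∈ D.O) : D.res (x + y) = D.res x + D.res y := by
  simp only [res, hx, hy, add_mem hx hy, dif_pos]
  rw [← map_add]
  rfl

theorem res_eq_zero {x : F} (hx : 0 < D.ν x) : D.res x = 0 := by
  have hO : x ∈ D.O := mem_O.2 hx.le
  rw [res, dif_pos hO]
  by_contra h
  obtain ⟨⟨y, hy⟩, hy'⟩ := D.ρ_surjective (D.ρ ⟨x, hO⟩)⁻¹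
  have h1 : D.ρ (1 - ⟨x, hO⟩ * ⟨y, hy⟩) = 0 := by
    rw [map_sub, map_one, map_mul, hy', mul_inv_cancel₀ h, sub_self]
  have hxy : 0 < D.ν (x * y) := by
    rw [AddValuation.map_mul]
    exact add_pos_of_pos_of_nonneg hx (mem_O.1 hy)
  have h2 : D.ν (1 - x * y) = 0 := by
    rw [AddValuation.map_sub_eq_of_lt_left D.ν (by rwa [AddValuation.map_one]),
      AddValuation.map_one]
  have hne : 1 - x * y ≠ 0 := by
    intro h0
    rw [h0, AddValuation.map_zero] at h2
    exact absurd h2 (by simp)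
  have h3 : D.ν (1 - x * y)⁻¹ = 0 := by
    have := AddValuation.map_mul D.ν (1 - x * y) (1 - x * y)⁻¹
    rw [mul_inv_cancel₀ hne, h2, AddValuation.map_one, zero_add] at this
    exact this.symm
  have h4 : (1 - ⟨x, hO⟩ * ⟨y, hy⟩ : D.O) * ⟨(1 - x * y)⁻¹, mem_O.2 h3.ge⟩ = 1 :=
    Subtype.ext (mul_inv_cancel₀ hne)
  have := congrArg D.ρ h4
  rw [map_mul, h1, zero_mul, map_one] at this
  exact zero_ne_one this

/-- On the ball `a₀ + t(γ₀) O`, a lift `g^{a,γ}` with `γ ≤ γ₀` is a translate of `g` (for the same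
ball) or constant. -/
theorem lift_ball {A : Type*} [Zero A] (g : k → A) (a a₀ : F) (γ γ₀ : Γ) (hγ : γ ≤ γ₀) (y : F)
    (hy : y ∈ D.O) :
    (γ = γ₀ ∧ (a₀ - a) * D.tF (-γ₀) ∈ D.O →
      D.lift g a γ (a₀ + D.tF γ₀ * y) = g (D.res ((a₀ - a) * D.tF (-γ₀)) + D.res y)) ∧
    (¬ (γ = γ₀ ∧ (a₀ - a) * D.tF (-γ₀) ∈ D.O) →
      D.lift g a γ (a₀ + D.tF γ₀ * y) = D.lift g a γ a₀) := by
  have hx : (a₀ + D.tF γ₀ * y - a) * D.tF (-γ) =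
      (a₀ - a) * D.tF (-γ) + D.tF (γ₀ - γ) * y := by
    rw [sub_eq_add_neg γ₀, tF_add]
    ring
  have hν : D.ν (D.tF (γ₀ - γ) * y) = ((γ₀ - γ : Γ) : WithTop Γ) + D.ν y := by
    rw [AddValuation.map_mul, ν_tF]
  have hmem : D.tF (γ₀ - γ) * y ∈ D.O := by
    rw [mem_O, hν]
    exact add_nonneg (by exact_mod_cast sub_nonneg.2 hγ) (mem_O.1 hy)
  constructor
  · rintro ⟨rfl, hz⟩
    have h1 : D.tF (γ - γ) * y = y := by rw [sub_eq_add_neg, tF_add, tF_mul_neg, one_mul]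
    rw [h1] at hx
    rw [lift, hx, if_pos (add_mem hz hy), res_add hz hy]
  · intro hP
    by_cases hz : (a₀ - a) * D.tF (-γ) ∈ D.O
    · have hlt : γ < γ₀ := lt_of_le_of_ne hγ fun h => hP ⟨h, h ▸ hz⟩
      have h0 : D.res (D.tF (γ₀ - γ) * y) = 0 := by
        refine res_eq_zero ?_
        rw [hν]
        exact add_pos_of_pos_of_nonneg (by exact_mod_cast sub_pos.2 hlt) (mem_O.1 hy)
      rw [lift, hx, if_pos (add_mem hz hmem), res_add hz hmem, h0, add_zero, lift, if_pos hz]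
    · rw [lift, hx, if_neg ((add_mem_cancel_right hmem).not.2 hz), lift, if_neg hz]

theorem lift_off_ball {A : Type*} [Zero A] (g : k → A) (a a₀ : F) (γ : Γ)
    (h : (a₀ - a) * D.tF (-γ) ∈ D.O) (x : F) (hx : (x - a₀) * D.tF (-γ) ∉ D.O) :
    D.lift g a γ x = 0 := by
  rw [lift, if_neg]
  rw [show (x - a) * D.tF (-γ) = (x - a₀) * D.tF (-γ) + (a₀ - a) * D.tF (-γ) by ring]
  exact (add_mem_cancel_right h).not.2 hx

end Algebra

section Integral

variable [NontriviallyNormedField k] [LocallyCompactSpace k] [MeasurableSpace k] [BorelSpace k]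
  (D : SplitValuedField F Γ k) (μ : Measure k)

/-- The `ℂ(Γ)`-valued absolute value `|α| = |res (α t(-ν α))| X^{ν α}` on `Fˣ`. -/
def absF (α : Fˣ) : CC Γ :=
  ofC Γ (modulus (D.res ((α : F) * D.tF (-D.val α))) : ℂ) * X (D.val α)

/-- Simple functions `x ↦ g^{a,γ}(x) X^δ` on `F`, for `g` Haar integrable on `k`. -/
def IsSimple (f : F → CC Γ) : Prop :=
  ∃ (g : k → ℂ) (a : F) (γ δ : Γ), Integrable g μ ∧ f = fun x => ofC Γ (D.lift g a γ x) * X δ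

/-- The space of integrable functions on `F`: the `ℂ(Γ)`-span of the simple functions. -/
def integrableFunctions : Submodule (CC Γ) (F → CC Γ) :=
  Submodule.span (CC Γ) {f | D.IsSimple μ f}

variable {D μ}

theorem const_comb [μ.IsAddHaarMeasure] {ι : Type*} (s : Finset ι) (c : ι → CC Γ) (g : ι → k → ℂ)
    (β : ι → k) (hg : ∀ i, Integrable (g i) μ) (C : CC Γ)
    (h : ∀ u, ∑ i ∈ s, c i * ofC Γ (g i (β i + u)) = C) :
    C = 0 ∧ ∑ i ∈ s, c i * ofC Γ (∫ u, g i u ∂μ) = 0 := by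
  have key : ∀ φ : Module.Dual ℂ (CC Γ),
      φ C = 0 ∧ φ (∑ i ∈ s, c i * ofC Γ (∫ u, g i u ∂μ)) = 0 := by
    intro φ
    have hφ : ∀ (i : ι) (w : ℂ), φ (c i * ofC Γ w) = w * φ (c i) := by
      intro i w
      rw [mul_comm, ofC, ← Algebra.smul_def, map_smul, smul_eq_mul]
    have h1 : ∀ u, ∑ i ∈ s, g i (β i + u) * φ (c i) = φ C := by
      intro u
      rw [← h u, map_sum]
      exact Finset.sum_congr rfl fun i _ => (hφ _ _).symm
    have hint : ∀ i ∈ s, Integrable (fun u => g i (β i + u) * φ (c i)) μ := fun i _ =>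
      ((hg i).comp_add_left (β i)).mul_const _
    have h2 : Integrable (fun _ : k => φ C) μ := by
      have := integrable_finsetSum s hint
      simpa only [h1] using this
    have h3 : φ C = 0 := by
      rw [integrable_const_iff] at h2
      rcases h2 with h2 | h2
      · exact h2
      · exact absurd h2.measure_univ_lt_top (by simp [measure_univ_of_isAddLeftInvariant])
    refine ⟨h3, ?_⟩
    rw [map_sum]
    have h4 := integral_finsetSum (μ := μ) s hint
    simp only [h1, h3, integral_zero, integral_mul_const, integral_add_left_eq_self] at h4
    rw [h4]
    exact Finset.sum_congr rfl fun i _ => hφ _ _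
  exact ⟨(Module.forall_dual_apply_eq_zero_iff ℂ _).1 fun φ => (key φ).1,
    (Module.forall_dual_apply_eq_zero_iff ℂ _).1 fun φ => (key φ).2⟩

/-- A vanishing combination of lifts has vanishing combination of integrals. -/
theorem sum_integral_eq_zero [μ.IsAddHaarMeasure] {ι : Type*} (c : ι → CC Γ) (g : ι → k → ℂ)
    (a : ι → F) (γ : ι → Γ) (hg : ∀ i, Integrable (g i) μ) (s : Finset ι)
    (h : ∀ x, ∑ i ∈ s, c i * ofC Γ (D.lift (g i) (a i) (γ i) x) = 0) :
    ∑ i ∈ s, c i * (ofC Γ (∫ u, g i u ∂μ) * X (γ i)) = 0 := by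
  classical
  induction s using Finset.strongInduction with
  | H s ih =>
  rcases s.eq_empty_or_nonempty with rfl | hs
  · simp
  obtain ⟨i₀, hi₀, hmax⟩ := s.exists_max_image γ hs
  let P : ι → Prop := fun i => γ i = γ i₀ ∧ (a i₀ - a i) * D.tF (-γ i₀) ∈ D.O
  have hP₀ : P i₀ := ⟨rfl, by simp⟩
  set C := -∑ i ∈ s with ¬ P i, c i * ofC Γ (D.lift (g i) (a i) (γ i) (a i₀)) with hC
  have hball : ∀ y ∈ D.O, ∑ i ∈ s with P i, c i *
      ofC Γ (g i (D.res ((a i₀ - a i) * D.tF (-γ i₀)) + D.res y)) = C := by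
    intro y hy
    have h1 := h (a i₀ + D.tF (γ i₀) * y)
    rw [← Finset.sum_filter_add_sum_filter_not s P] at h1
    rw [hC]
    refine Eq.trans (Eq.trans ?_ (eq_neg_iff_add_eq_zero.2 h1)) ?_
    · refine Finset.sum_congr rfl fun i hi => ?_
      rw [Finset.mem_filter] at hi
      rw [(lift_ball (g i) (a i) (a i₀) (γ i) (γ i₀) (hmax i hi.1) y hy).1 hi.2]
    · congr 1
      refine Finset.sum_congr rfl fun i hi => ?_
      rw [Finset.mem_filter] at hi
      rw [(lift_ball (g i) (a i) (a i₀) (γ i) (γ i₀) (hmax i hi.1) y hy).2 hi.2]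
  have hk := const_comb (μ := μ) (s.filter P) c g
    (fun i => D.res ((a i₀ - a i) * D.tF (-γ i₀))) hg C (by
      intro u
      obtain ⟨⟨y, hy⟩, rfl⟩ := D.ρ_surjective u
      have := hball y hy
      simpa [res, hy] using this)
  have hTzero : ∀ x, ∑ i ∈ s with P i, c i * ofC Γ (D.lift (g i) (a i) (γ i) x) = 0 := by
    intro x
    by_cases hx : (x - a i₀) * D.tF (-γ i₀) ∈ D.O
    · rw [← hk.1, ← hball _ hx]
      refine Finset.sum_congr rfl fun i hi => ?_
      rw [Finset.mem_filter] at hi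
      rw [← (lift_ball (g i) (a i) (a i₀) (γ i) (γ i₀) (hmax i hi.1) _ hx).1 hi.2]
      rw [mul_left_comm, tF_mul_neg, mul_one, add_sub_cancel]
    · refine Finset.sum_eq_zero fun i hi => ?_
      rw [Finset.mem_filter] at hi
      rw [lift_off_ball (g i) (a i) (a i₀) (γ i) (by rw [hi.2.1]; exact hi.2.2) x
        (by rw [hi.2.1]; exact hx)]
      simp
  rw [← Finset.sum_filter_add_sum_filter_not s P]
  have h1 : ∑ i ∈ s with P i, c i * (ofC Γ (∫ u, g i u ∂μ) * X (γ i)) = 0 := by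
    have : ∑ i ∈ s with P i, c i * (ofC Γ (∫ u, g i u ∂μ) * X (γ i)) =
        (∑ i ∈ s with P i, c i * ofC Γ (∫ u, g i u ∂μ)) * X (γ i₀) := by
      rw [Finset.sum_mul]
      refine Finset.sum_congr rfl fun i hi => ?_
      rw [Finset.mem_filter] at hi
      rw [hi.2.1, mul_assoc]
    rw [this, hk.2, zero_mul]
  rw [h1, zero_add]
  refine ih _ ?_ fun x => ?_
  · exact Finset.filter_ssubset.2 ⟨i₀, hi₀, not_not.2 hP₀⟩
  · have := h x
    rwa [← Finset.sum_filter_add_sum_filter_not s P, hTzero x, zero_add] at this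

theorem lift_mem {g : k → ℂ} (hg : Integrable g μ) (a : F) (γ : Γ) :
    (fun x => ofC Γ (D.lift g a γ x)) ∈ D.integrableFunctions μ := by
  refine Submodule.subset_span ⟨g, a, γ, 0, hg, ?_⟩
  funext x
  have : X (0 : Γ) = 1 := by rw [X, ← AddMonoidAlgebra.one_def, map_one]
  rw [this, mul_one]

variable (D μ)

/-- Existence of the integral on `F`: there is a `ℂ(Γ)`-linear functional on the integrable
functions with `∫ g^{a,γ} = (∫ g) X^γ` for all Haar integrable `g`; it is unique because the
lifts `g^{a,γ}` span. -/
theorem exists_integral [μ.IsAddHaarMeasure] : ∃ I : D.integrableFunctions μ →ₗ[CC Γ] CC Γ,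
    ∀ (g : k → ℂ) (hg : Integrable g μ) (a : F) (γ : Γ),
      I ⟨fun x => ofC Γ (D.lift g a γ x), lift_mem hg a γ⟩ = ofC Γ (∫ u, g u ∂μ) * X γ := by
  classical
  let S := {g : k → ℂ // Integrable g μ} × F × Γ
  let T : (S →₀ CC Γ) →ₗ[CC Γ] (F → CC Γ) :=
    Finsupp.linearCombination (CC Γ) fun p : S => fun x => ofC Γ (D.lift p.1.1 p.2.1 p.2.2 x)
  let J : (S →₀ CC Γ) →ₗ[CC Γ] CC Γ :=
    Finsupp.linearCombination (CC Γ) fun p : S => ofC Γ (∫ u, p.1.1 u ∂μ) * X p.2.2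
  have hTJ : ∀ c, T c = 0 → J c = 0 := by
    intro c hc
    have := sum_integral_eq_zero (D := D) (μ := μ) (fun p : S => c p) (fun p => p.1.1)
      (fun p => p.2.1) (fun p => p.2.2) (fun p => p.1.2) c.support (by
        intro x
        have := congrFun hc x
        simpa [T, Finsupp.linearCombination_apply, Finsupp.sum, Finset.sum_apply] using this)
    simpa [J, Finsupp.linearCombination_apply, Finsupp.sum] using this
  have hle : D.integrableFunctions μ ≤ LinearMap.range T := by
    refine Submodule.span_le.2 ?_
    rintro _ ⟨g, a, γ, δ, hg, rfl⟩
    refine ⟨Finsupp.single (⟨g, hg⟩, a, γ) (X δ), ?_⟩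
    funext x
    simp [T, Finsupp.linearCombination_single, mul_comm]
  have : Module.Free (CC Γ) (LinearMap.range T) := Module.Free.of_divisionRing _ _
  obtain ⟨σ, hσ⟩ := T.rangeRestrict.exists_rightInverse_of_surjective T.range_rangeRestrict
  refine ⟨J ∘ₗ σ ∘ₗ Submodule.inclusion hle, fun g hg a γ => ?_⟩
  set f : D.integrableFunctions μ := ⟨fun x => ofC Γ (D.lift g a γ x), lift_mem hg a γ⟩
  set e : S →₀ CC Γ := Finsupp.single (⟨g, hg⟩, a, γ) 1
  have hTe : T e = f.1 := by
    simp [T, e, f, Finsupp.linearCombination_single]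
  have hTσ : T (σ (Submodule.inclusion hle f)) = f.1 :=
    congrArg Subtype.val (LinearMap.congr_fun hσ (Submodule.inclusion hle f))
  have := hTJ (σ (Submodule.inclusion hle f) - e) (by rw [map_sub, hTe, hTσ, sub_self])
  rw [map_sub, sub_eq_zero] at this
  change J (σ (Submodule.inclusion hle f)) = _
  rw [this]
  simp [J, e, Finsupp.linearCombination_single]

/-- The integral `∫^F f` of an integrable function `f : F → ℂ(Γ)` (and `0` for other functions). -/
def integral [μ.IsAddHaarMeasure] (f : F → CC Γ) : CC Γ :=
  open Classical in
  if h : f ∈ D.integrableFunctions μ then (D.exists_integral μ).choose ⟨f, h⟩ else 0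

/-- The function `(x_1, .., x_r omitted, .., x_{n+1}) ↦ ∫^F f(x_1, .., x_{n+1}) dx_r`. -/
def partialIntegral [μ.IsAddHaarMeasure] {n : ℕ} (r : Fin (n + 1)) (f : (Fin (n + 1) → F) → CC Γ)
    (x : Fin n → F) : CC Γ :=
  D.integral μ fun s => f (r.insertNth s x)

/-- The repeated integral `∫^{F^n} f`, evaluated by integrating out the first variable first;
for a Fubini function the order does not matter. On `F^0`, a point, it is the value of `f`, so that
on `F^1` it is the integral over `F`. -/
def repeatedIntegral [μ.IsAddHaarMeasure] : (n : ℕ) → ((Fin n → F) → CC Γ) → CC Γ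
  | 0, f => f Fin.elim0
  | n + 1, f => repeatedIntegral n (D.partialIntegral μ 0 f)

/-- Fubini functions on `F^n`. The recursion starts at `n = 0`, where every function is Fubini;
for `n = 1` the condition then says that `f` is integrable on `F`. -/
def IsFubini [μ.IsAddHaarMeasure] : (n : ℕ) → ((Fin n → F) → CC Γ) → Prop
  | 0, _ => True
  | n + 1, f =>
    (∀ (r : Fin (n + 1)) (x : Fin n → F),
      (fun s => f (r.insertNth s x)) ∈ D.integrableFunctions μ) ∧
    (∀ r : Fin (n + 1), IsFubini n (D.partialIntegral μ r f)) ∧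
    ∀ r r' : Fin (n + 1), D.repeatedIntegral μ n (D.partialIntegral μ r f) =
      D.repeatedIntegral μ n (D.partialIntegral μ r' f)

end Integral

end SplitValuedField

section Residue

variable {k : Type*} [NontriviallyNormedField k] [MeasurableSpace k]

/-- Fubini functions on `k^n`: `g` is Haar integrable on `k^n`, every section `u_r ↦ g(u_1, .., u_n)`
is Haar integrable, and all the partial integrals are Fubini on `k^{n-1}`. (That the repeated
integrals in different orders agree is then automatic, by Fubini's theorem.) -/
def IsResidueFubini (μ : Measure k) : (n : ℕ) → ((Fin n → k) → ℂ) → Prop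
  | 0, _ => True
  | n + 1, g =>
    Integrable g (Measure.pi fun _ => μ) ∧
    (∀ (r : Fin (n + 1)) (u : Fin n → k), Integrable (fun s => g (r.insertNth s u)) μ) ∧
    ∀ r : Fin (n + 1), IsResidueFubini μ n fun u => ∫ s, g (r.insertNth s u) ∂μ

/-- GL-Fubini functions on `k^n`: `g ∘ τ` is Fubini for all `τ ∈ GL_n(k)`. -/
def IsGLFubini (μ : Measure k) (n : ℕ) (g : (Fin n → k) → ℂ) : Prop :=
  ∀ τ : Matrix.GeneralLinearGroup (Fin n) k, IsResidueFubini μ n fun u => g (τ.1.mulVec u)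

/-- The space `L(F^n, GL_n)`: the `ℂ(Γ)`-span of the functions `g^{a,γ} ∘ τ` for `g` GL-Fubini. -/
def SplitValuedField.spaceGL {F Γ : Type*} [Field F] [AddCommGroup Γ] [LinearOrder Γ]
    [IsOrderedAddMonoid Γ] (D : SplitValuedField F Γ k) (μ : Measure k)
    (n : ℕ) :
    Submodule (CC Γ) ((Fin n → F) → CC Γ) :=
  Submodule.span (CC Γ) {f | ∃ (g : (Fin n → k) → ℂ) (τ : Matrix.GeneralLinearGroup (Fin n) F)
    (a : Fin n → F) (γ : Fin n → Γ), IsGLFubini μ n g ∧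
      f = fun x => ofC Γ (D.liftN g a γ (τ.1.mulVec x))}

end Residue

end ResidueIntegration

end

open MeasureTheory

noncomputable section

namespace ResidueIntegration

/-! ### Powers of `X` in `ℂ(Γ)`. -/

section GroupAlgebra

variable {Γ : Type*} [AddCommGroup Γ] [LinearOrder Γ] [IsOrderedAddMonoid Γ]

/-! By linearity it is enough to treat a generator. Centre, radii, translations and linear maps can
all be absorbed into one affine map, so the generator becomes `x ↦ g^{0,0}(Mx + b)` with `M`
invertible. The claim is that this function is Fubini with repeated integral `|det M|⁻¹ ∫ g`. Both
transformation formulas follow, since the value depends on the affine map only through `det M`.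

The claim is proved by induction on the dimension (`isFubini_liftN_affine`). To integrate out `x_r`,
take as pivot an entry `α = M j r` of least valuation in column `r`; the other entries of the column
are `w_i α` with `w_i ∈ O` (`exists_pivot`). If `z` is the `j`-th coordinate of `Mx + b`, the other
coordinates are `y + z w`, where `y = M'x' + b'` is free of `x_r`. Because `w` is integral, all
coordinates are integral exactly when `z` and `y` are, and residues are taken termwise. Hence the
section is a lift of `g` restricted to a line of direction `res w` (`liftN_insertNth`).

Its integral is `|α|⁻¹` times the lift of a line integral of `g`, evaluated at `M'x' + b'`: the same
shape in one dimension less. GL-Fubini is what makes integrals along oblique lines exist and be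
GL-Fubini again. Fubini's theorem on the residue side preserves `∫ g` (`integral_lineIntegral`), and
`det M = ± α det M'` (`det_eq_pivotMinor`). The resulting value does not involve `r`, so the order
of integration is immaterial. -/

theorem X_zero : X (0 : Γ) = 1 := by
  rw [X, ← AddMonoidAlgebra.one_def, map_one]

theorem X_add (γ δ : Γ) : X (γ + δ) = X γ * X δ := by
  rw [X, X, X, ← map_mul, AddMonoidAlgebra.single_mul_single, mul_one]

theorem X_neg (γ : Γ) : X (-γ) = (X γ)⁻¹ :=
  eq_inv_of_mul_eq_one_left (by rw [← X_add, neg_add_cancel, X_zero])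

end GroupAlgebra

/-! ### Scaling of Haar measure on the residue field. -/

section Modulus

variable {k : Type*} [NontriviallyNormedField k] [LocallyCompactSpace k]

theorem modulus_of_ne_zero {u : k} (h : u ≠ 0) :
    modulus u = (distribHaarChar k (Units.mk0 u h) : ℝ) := by
  simp [modulus, h]

theorem modulus_pos {u : k} (h : u ≠ 0) : 0 < modulus u := by
  rw [modulus_of_ne_zero h]
  exact_mod_cast distribHaarChar_pos

theorem modulus_mul {u v : k} (hu : u ≠ 0) (hv : v ≠ 0) :
    modulus (u * v) = modulus u * modulus v := by
  rw [modulus_of_ne_zero hu, modulus_of_ne_zero hv, modulus_of_ne_zero (mul_ne_zero hu hv),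
    Units.mk0_mul, map_mul, NNReal.coe_mul]

variable [MeasurableSpace k] [BorelSpace k] (μ : Measure k) [μ.IsAddHaarMeasure]

open scoped Pointwise in
theorem map_mul_left_eq_modulus_inv_smul {u : k} (h : u ≠ 0) :
    μ.map (u * ·) = ENNReal.ofReal (modulus u)⁻¹ • μ := by
  have : ProperSpace k := .of_locallyCompactSpace k
  ext s hs
  rw [Measure.map_apply (measurable_const_mul u) hs, Measure.smul_apply, smul_eq_mul]
  have h1 : (u * ·) ⁻¹' s = (Units.mk0 u h)⁻¹ • s := by
    ext x
    rw [Set.mem_inv_smul_set_iff]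
    rfl
  rw [h1, ← distribHaarChar_mul, map_inv, modulus_of_ne_zero h, ← NNReal.coe_inv,
    ENNReal.ofReal_coe_nnreal]

theorem integrable_comp_mul_left {u : k} (h : u ≠ 0) {φ : k → ℂ} (hφ : Integrable φ μ) :
    Integrable (fun s => φ (u * s)) μ := by
  have he : MeasurableEmbedding (u * · : k → k) := (MeasurableEquiv.mulLeft₀ u h).measurableEmbedding
  refine (he.integrable_map_iff (g := φ)).1 ?_
  rw [map_mul_left_eq_modulus_inv_smul μ h]
  exact hφ.smul_measure ENNReal.ofReal_ne_top

theorem integral_comp_mul_left {u : k} (h : u ≠ 0) (φ : k → ℂ) :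
    ∫ s, φ (u * s) ∂μ = (modulus u : ℂ)⁻¹ * ∫ s, φ s ∂μ := by
  have he : MeasurableEmbedding (u * · : k → k) := (MeasurableEquiv.mulLeft₀ u h).measurableEmbedding
  rw [← he.integral_map, map_mul_left_eq_modulus_inv_smul μ h, integral_smul_measure,
    ENNReal.toReal_ofReal (inv_nonneg.2 (modulus_pos h).le), Complex.real_smul, Complex.ofReal_inv]

end Modulus

namespace SplitValuedField

variable {F Γ k : Type*} [Field F] [AddCommGroup Γ] [LinearOrder Γ] [IsOrderedAddMonoid Γ]

/-! ### Residues of units and one-variable lifts under affine maps. -/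

section Algebra

variable [Field k] (D : SplitValuedField F Γ k)

theorem coe_val (α : Fˣ) : (D.val α : WithTop Γ) = D.ν (α : F) := by
  obtain ⟨γ, hγ⟩ := WithTop.ne_top_iff_exists.1 (mt D.ν.top_iff.1 α.ne_zero)
  rw [val, ← hγ, WithTop.untopD_coe]

theorem val_mul (α β : Fˣ) : D.val (α * β) = D.val α + D.val β := by
  have h : (D.val (α * β) : WithTop Γ) = D.val α + D.val β := by
    simp only [coe_val, Units.val_mul, AddValuation.map_mul]
  exact_mod_cast h

theorem ν_mul_tF_neg_val (α : Fˣ) : D.ν ((α : F) * D.tF (-D.val α)) = 0 := by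
  rw [AddValuation.map_mul, ν_tF, ← coe_val, ← WithTop.coe_add, add_neg_cancel, WithTop.coe_zero]

theorem mul_tF_neg_val_mem (α : Fˣ) : (α : F) * D.tF (-D.val α) ∈ D.O :=
  mem_O.2 (D.ν_mul_tF_neg_val α).ge

variable {D}

theorem res_mul {x y : F} (hx : x ∈ D.O) (hy : y ∈ D.O) :
    D.res (x * y) = D.res x * D.res y := by
  simp only [res, hx, hy, mul_mem hx hy, dif_pos]
  rw [← map_mul]
  rfl

theorem res_one : D.res (1 : F) = 1 := by
  rw [res, dif_pos (one_mem _)]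
  exact map_one D.ρ

theorem inv_mem_of_ν_eq_zero {x : F} (hx : D.ν x = 0) : x⁻¹ ∈ D.O := by
  have hne : x ≠ 0 := by
    rintro rfl
    simp at hx
  have := AddValuation.map_mul D.ν x x⁻¹
  rw [mul_inv_cancel₀ hne, hx, AddValuation.map_one, zero_add] at this
  exact mem_O.2 this.le

theorem res_ne_zero {x : F} (hx : D.ν x = 0) : D.res x ≠ 0 := by
  have hne : x ≠ 0 := by
    rintro rfl
    simp at hx
  have := res_mul (mem_O.2 hx.ge) (inv_mem_of_ν_eq_zero hx)
  rw [mul_inv_cancel₀ hne, res_one] at this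
  exact left_ne_zero_of_mul (this ▸ one_ne_zero)

theorem mul_mem_iff_of_ν_eq_zero {u : F} (hu : D.ν u = 0) (x : F) : u * x ∈ D.O ↔ x ∈ D.O := by
  rw [mem_O, mem_O, AddValuation.map_mul, hu, zero_add]

/-- The lift of a function on `k` to `O`, composed with an affine map of `F`. -/
theorem lift_affine {A : Type*} [Zero A] (D : SplitValuedField F Γ k) (φ : k → A) (α : Fˣ) (b s : F) :
    D.lift φ 0 0 (α * s + b) =
      D.lift (fun u => φ (D.res ((α : F) * D.tF (-D.val α)) * u)) (-(b / α)) (-D.val α) s := by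
  have hα := α.ne_zero
  -- `α` is the unit `α t(-ν α)` times `t(ν α)`: the second factor changes the radius of the ball,
  -- the unit only scales the residue.
  have h : (α * s + b - 0) * D.tF (-0) =
      (α * D.tF (-D.val α)) * ((s - -(b / α)) * D.tF (- -D.val α)) := by
    have h1 := D.tF_mul_neg (-D.val α)
    have h0 : D.tF (-0) = 1 := by simp [tF]
    rw [h0]
    field_simp
    linear_combination (-(α * s + b)) * h1
  rw [lift, lift, h]
  by_cases hm : (s - -(b / α)) * D.tF (- -D.val α) ∈ D.O
  · rw [if_pos hm, if_pos (mul_mem (D.mul_tF_neg_val_mem α) hm),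
      res_mul (D.mul_tF_neg_val_mem α) hm]
  · rw [if_neg hm, if_neg ((mul_mem_iff_of_ν_eq_zero (D.ν_mul_tF_neg_val α) _).not.2 hm)]

end Algebra

/-! ### The absolute value on `Fˣ` and the integral on `F`. -/

section Integral

variable [NontriviallyNormedField k] [LocallyCompactSpace k] (D : SplitValuedField F Γ k)

theorem absF_mul (α β : Fˣ) : D.absF (α * β) = D.absF α * D.absF β := by
  have h : ((α * β : Fˣ) : F) * D.tF (-D.val (α * β)) =
      (α * D.tF (-D.val α)) * (β * D.tF (-D.val β)) := by
    rw [val_mul, neg_add, tF_add, Units.val_mul]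
    ring
  rw [absF, absF, absF, h, res_mul (D.mul_tF_neg_val_mem α) (D.mul_tF_neg_val_mem β),
    modulus_mul (res_ne_zero (D.ν_mul_tF_neg_val α)) (res_ne_zero (D.ν_mul_tF_neg_val β)),
    val_mul, X_add, Complex.ofReal_mul, map_mul]
  ring

theorem absF_inv_eq (α : Fˣ) : (D.absF α)⁻¹ =
    ofC Γ (modulus (D.res ((α : F) * D.tF (-D.val α))) : ℂ)⁻¹ * X (-D.val α) := by
  rw [absF, mul_inv, X_neg, map_inv₀]

theorem absF_ne_zero (α : Fˣ) : D.absF α ≠ 0 := by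
  refine mul_ne_zero ?_ (left_ne_zero_of_mul (b := X (-D.val α)) ?_)
  · rw [map_ne_zero]
    exact_mod_cast (modulus_pos (res_ne_zero (D.ν_mul_tF_neg_val α))).ne'
  · rw [← X_add, add_neg_cancel, X_zero]
    exact one_ne_zero

theorem absF_one : D.absF 1 = 1 := by
  have h := D.absF_mul 1 1
  rw [mul_one] at h
  exact (mul_eq_left₀ (D.absF_ne_zero 1)).1 h.symm

/-- Since `ν(-1) = 0`, this is a positive real number, and its square is `|1| = 1`. It disposes of
the signs in cofactor expansions. -/
theorem absF_neg_one : D.absF (-1) = 1 := by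
  have hν : D.ν (-1 : F) = 0 := by rw [AddValuation.map_neg, AddValuation.map_one]
  have hval : D.val (-1) = 0 := by
    have : (D.val (-1) : WithTop Γ) = 0 := by rw [coe_val, Units.val_neg, Units.val_one, hν]
    exact_mod_cast this
  have h := D.absF_mul (-1) (-1)
  rw [neg_one_mul, neg_neg, absF_one] at h
  rw [absF, hval, X_zero, mul_one, ← map_mul, eq_comm, map_eq_one_iff _ (ofC Γ).injective] at h
  rw [absF, hval, X_zero, mul_one]
  set m := modulus (D.res (((-1 : Fˣ) : F) * D.tF (-0)))
  have hm : 0 ≤ m := by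
    have := modulus_pos (res_ne_zero (D.ν_mul_tF_neg_val (-1)))
    rw [hval] at this
    exact this.le
  have h2 : m * m = 1 := by exact_mod_cast h
  have h3 : m = 1 := by nlinarith
  rw [h3, Complex.ofReal_one, map_one]

theorem absF_neg_one_pow_mul (m : ℕ) (α : Fˣ) : D.absF ((-1) ^ m * α) = D.absF α := by
  rcases neg_one_pow_eq_or Fˣ m with h | h <;> rw [h, absF_mul]
  · rw [absF_one, one_mul]
  · rw [absF_neg_one, one_mul]

variable [MeasurableSpace k] [BorelSpace k] (μ : Measure k) [μ.IsAddHaarMeasure]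

theorem integral_add {f g : F → CC Γ} (hf : f ∈ D.integrableFunctions μ)
    (hg : g ∈ D.integrableFunctions μ) :
    D.integral μ (fun x => f x + g x) = D.integral μ f + D.integral μ g := by
  have h : (fun x => f x + g x) ∈ D.integrableFunctions μ := add_mem hf hg
  rw [integral, integral, integral, dif_pos hf, dif_pos hg, dif_pos h, ← map_add]
  rfl

theorem integral_smul (c : CC Γ) {f : F → CC Γ} (hf : f ∈ D.integrableFunctions μ) :
    D.integral μ (fun x => c * f x) = c * D.integral μ f := by
  have h : (fun x => c * f x) ∈ D.integrableFunctions μ := Submodule.smul_mem _ c hf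
  rw [integral, integral, dif_pos hf, dif_pos h, ← smul_eq_mul, ← map_smul]
  rfl

theorem integral_lift {g : k → ℂ} (hg : Integrable g μ) (a : F) (γ : Γ) :
    D.integral μ (fun x => ofC Γ (D.lift g a γ x)) = ofC Γ (∫ u, g u ∂μ) * X γ := by
  rw [integral, dif_pos (lift_mem hg a γ)]
  exact (D.exists_integral μ).choose_spec g hg a γ

theorem integral_zero : D.integral μ (fun _ => 0) = 0 := by
  simpa using D.integral_smul μ 0 (zero_mem _)

theorem lift_affine_mem {φ : k → ℂ} (hφ : Integrable φ μ) (α : Fˣ) (b : F) :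
    (fun s => ofC Γ (D.lift φ 0 0 (α * s + b))) ∈ D.integrableFunctions μ := by
  simp only [lift_affine]
  exact lift_mem (integrable_comp_mul_left μ (res_ne_zero (D.ν_mul_tF_neg_val α)) hφ) _ _

theorem integral_lift_affine {φ : k → ℂ} (hφ : Integrable φ μ) (α : Fˣ) (b : F) :
    D.integral μ (fun s => ofC Γ (D.lift φ 0 0 (α * s + b))) =
      (D.absF α)⁻¹ * ofC Γ (∫ u, φ u ∂μ) := by
  have hu := res_ne_zero (D.ν_mul_tF_neg_val α)
  simp only [lift_affine]
  rw [integral_lift D μ (integrable_comp_mul_left μ hu hφ), integral_comp_mul_left μ hu,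
    absF_inv_eq, map_mul]
  ring

/-! ### Linear combinations of Fubini functions -/

variable {D μ}

/-- Integrability of all sections is assumed because `integral` takes the default value 0 elsewhere
and is linear only on integrable functions. -/
theorem partialIntegral_add {n : ℕ} (r : Fin (n + 1)) {f g : (Fin (n + 1) → F) → CC Γ}
    (hf : ∀ x, (fun s => f (r.insertNth s x)) ∈ D.integrableFunctions μ)
    (hg : ∀ x, (fun s => g (r.insertNth s x)) ∈ D.integrableFunctions μ) :
    D.partialIntegral μ r (fun x => f x + g x) =
      fun x => D.partialIntegral μ r f x + D.partialIntegral μ r g x :=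
  funext fun x => D.integral_add μ (hf x) (hg x)

theorem partialIntegral_smul {n : ℕ} (r : Fin (n + 1)) (c : CC Γ)
    {f : (Fin (n + 1) → F) → CC Γ}
    (hf : ∀ x, (fun s => f (r.insertNth s x)) ∈ D.integrableFunctions μ) :
    D.partialIntegral μ r (fun x => c * f x) = fun x => c * D.partialIntegral μ r f x :=
  funext fun x => D.integral_smul μ c (hf x)

theorem repeatedIntegral_add {n : ℕ} {f g : (Fin n → F) → CC Γ} (hf : D.IsFubini μ n f)
    (hg : D.IsFubini μ n g) : D.repeatedIntegral μ n (fun x => f x + g x) =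
      D.repeatedIntegral μ n f + D.repeatedIntegral μ n g := by
  induction n with
  | zero => rfl
  | succ n ih =>
    rw [repeatedIntegral, partialIntegral_add 0 (hf.1 0) (hg.1 0), ih (hf.2.1 0) (hg.2.1 0)]
    rfl

theorem repeatedIntegral_smul {n : ℕ} (c : CC Γ) {f : (Fin n → F) → CC Γ}
    (hf : D.IsFubini μ n f) : D.repeatedIntegral μ n (fun x => c * f x) =
      c * D.repeatedIntegral μ n f := by
  induction n with
  | zero => rfl
  | succ n ih =>
    rw [repeatedIntegral, partialIntegral_smul 0 c (hf.1 0), ih (hf.2.1 0)]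
    rfl

theorem IsFubini.add {n : ℕ} {f g : (Fin n → F) → CC Γ} (hf : D.IsFubini μ n f)
    (hg : D.IsFubini μ n g) : D.IsFubini μ n (fun x => f x + g x) := by
  induction n with
  | zero => trivial
  | succ n ih =>
    refine ⟨fun r x => add_mem (hf.1 r x) (hg.1 r x), fun r => ?_, fun r r' => ?_⟩
    · rw [partialIntegral_add r (hf.1 r) (hg.1 r)]
      exact ih (hf.2.1 r) (hg.2.1 r)
    · rw [partialIntegral_add r (hf.1 r) (hg.1 r), partialIntegral_add r' (hf.1 r') (hg.1 r'),
        repeatedIntegral_add (hf.2.1 r) (hg.2.1 r), repeatedIntegral_add (hf.2.1 r') (hg.2.1 r'),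
        hf.2.2 r r', hg.2.2 r r']

theorem IsFubini.smul {n : ℕ} (c : CC Γ) {f : (Fin n → F) → CC Γ} (hf : D.IsFubini μ n f) :
    D.IsFubini μ n (fun x => c * f x) := by
  induction n with
  | zero => trivial
  | succ n ih =>
    refine ⟨fun r x => Submodule.smul_mem _ c (hf.1 r x), fun r => ?_, fun r r' => ?_⟩
    · rw [partialIntegral_smul r c (hf.1 r)]
      exact ih (hf.2.1 r)
    · rw [partialIntegral_smul r c (hf.1 r), partialIntegral_smul r' c (hf.1 r'),
        repeatedIntegral_smul c (hf.2.1 r), repeatedIntegral_smul c (hf.2.1 r'), hf.2.2 r r']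

variable (D μ)

theorem isFubini_zero (n : ℕ) : D.IsFubini μ n (fun _ => 0) := by
  induction n with
  | zero => trivial
  | succ n ih =>
    have h : ∀ r : Fin (n + 1), D.partialIntegral μ r (fun _ => 0) = fun _ => 0 := fun r =>
      funext fun _ => D.integral_zero μ
    refine ⟨fun r x => zero_mem _, fun r => ?_, fun r r' => ?_⟩
    · rw [h]
      exact ih
    · rw [h, h]

theorem repeatedIntegral_zero (n : ℕ) : D.repeatedIntegral μ n (fun _ => 0) = 0 := by
  simpa using repeatedIntegral_smul (D := D) (μ := μ) 0 (D.isFubini_zero μ n)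

end Integral

end SplitValuedField

/-! ### GL-Fubini functions on `k^n` and their line integrals. -/

section Residue

variable {k : Type*} [NontriviallyNormedField k]

/-- The linear automorphism of `k^{n+1}` which preserves the `j`-th coordinate `s` and sends the
vector `v` of the other coordinates to `σ v + s w`. -/
def shearEquiv {n : ℕ} (j : Fin (n + 1)) (σ : (Fin n → k) ≃ₗ[k] (Fin n → k)) (w : Fin n → k) :
    (Fin (n + 1) → k) ≃ₗ[k] (Fin (n + 1) → k) where
  toFun v := j.insertNth (α := fun _ => k) (v j) (σ (j.removeNth v) + v j • w)
  invFun v := j.insertNth (α := fun _ => k) (v j) (σ.symm (j.removeNth v - v j • w))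
  map_add' u v := by
    have h : j.removeNth (u + v) = j.removeNth u + j.removeNth v := rfl
    refine funext (j.forall_iff_succAbove.2 ⟨by simp, fun i => ?_⟩)
    simp only [h, map_add, Pi.add_apply, Fin.insertNth_apply_succAbove, Pi.smul_apply, smul_eq_mul]
    ring
  map_smul' c v := by
    have h : j.removeNth (c • v) = c • j.removeNth v := rfl
    refine funext (j.forall_iff_succAbove.2 ⟨by simp, fun i => ?_⟩)
    simp only [h, map_smul, Pi.add_apply, Fin.insertNth_apply_succAbove, Pi.smul_apply,
      smul_eq_mul, RingHom.id_apply]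
    ring
  left_inv v := by simp
  right_inv v := by simp

theorem shearEquiv_insertNth {n : ℕ} (j : Fin (n + 1)) (σ : (Fin n → k) ≃ₗ[k] (Fin n → k))
    (w : Fin n → k) (s : k) (v : Fin n → k) :
    shearEquiv j σ w (j.insertNth (α := fun _ => k) s v) =
      j.insertNth (α := fun _ => k) s (σ v + s • w) := by
  simp [shearEquiv]

variable [MeasurableSpace k] {μ : Measure k}

theorem IsGLFubini.comp_linearEquiv {n : ℕ} {g : (Fin n → k) → ℂ} (hg : IsGLFubini μ n g)
    (e : (Fin n → k) ≃ₗ[k] (Fin n → k)) : IsResidueFubini μ n fun u => g (e u) := by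
  let τ : Matrix.GeneralLinearGroup (Fin n) k :=
    ⟨LinearMap.toMatrix' e.toLinearMap, LinearMap.toMatrix' e.symm.toLinearMap,
      by rw [← LinearMap.toMatrix'_comp, LinearEquiv.comp_symm, LinearMap.toMatrix'_id],
      by rw [← LinearMap.toMatrix'_comp, LinearEquiv.symm_comp, LinearMap.toMatrix'_id]⟩
  have h : ∀ u, τ.1.mulVec u = e u := fun u => LinearMap.toMatrix'_mulVec _ u
  simpa only [h] using hg τ

/-- The integral of `g` along the lines in the direction of `w` with `j`-th coordinate `1`. -/
def lineIntegral (μ : Measure k) {n : ℕ} (j : Fin (n + 1)) (w : Fin n → k)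
    (g : (Fin (n + 1) → k) → ℂ) (v : Fin n → k) : ℂ :=
  ∫ s, g (j.insertNth (α := fun _ => k) s (v + s • w)) ∂μ

/-- A shear carries coordinate lines to lines of direction `w`, so this is section integrability for
`g` composed with the shear. -/
theorem IsGLFubini.integrable_line {n : ℕ} {g : (Fin (n + 1) → k) → ℂ}
    (hg : IsGLFubini μ (n + 1) g) (j : Fin (n + 1)) (w v : Fin n → k) :
    Integrable (fun s => g (j.insertNth (α := fun _ => k) s (v + s • w))) μ := by
  have := (hg.comp_linearEquiv (shearEquiv j (LinearEquiv.refl k _) w)).2.1 j v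
  simpa only [shearEquiv_insertNth, LinearEquiv.refl_apply] using this

/-- The line integral composed with `τ` is a coordinate partial integral of `g ∘ shearEquiv j σ w`,
where `σ` is the map of `τ`; this is why `shearEquiv` carries `σ` as well as `w`. -/
theorem IsGLFubini.lineIntegral {n : ℕ} {g : (Fin (n + 1) → k) → ℂ}
    (hg : IsGLFubini μ (n + 1) g) (j : Fin (n + 1)) (w : Fin n → k) :
    IsGLFubini μ n (lineIntegral μ j w g) := by
  intro τ
  let σ : (Fin n → k) ≃ₗ[k] (Fin n → k) := Matrix.toLin'OfInv τ.inv_val τ.val_inv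
  have h : ∀ v, τ.1.mulVec v = σ v := fun v => (Matrix.toLin'_apply _ _).symm
  have := (hg.comp_linearEquiv (shearEquiv j σ w)).2.2 j
  simp only [shearEquiv_insertNth] at this
  simp only [h]
  exact this

/-- After exchanging the order of integration, for fixed `s` the shear is the translation by `s •
w`, which leaves the integral over `v` unchanged. Integrability of both `g` and the sheared `g` is
used. -/
theorem integral_lineIntegral [LocallyCompactSpace k] [BorelSpace k] [μ.IsAddHaarMeasure] {n : ℕ}
    {g : (Fin (n + 1) → k) → ℂ} (hg : IsGLFubini μ (n + 1) g) (j : Fin (n + 1)) (w : Fin n → k) :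
    ∫ v, lineIntegral μ j w g v ∂(Measure.pi fun _ => μ) = ∫ u, g u ∂(Measure.pi fun _ => μ) := by
  have : ProperSpace k := .of_locallyCompactSpace k
  have hmp := (measurePreserving_piFinSuccAbove (fun _ : Fin (n + 1) => μ) j).symm
  have he := MeasurableEquiv.measurableEmbedding
    (MeasurableEquiv.piFinSuccAbove (fun _ : Fin (n + 1) => k) j).symm
  have hI : ∀ f : (Fin (n + 1) → k) → ℂ, Integrable f (Measure.pi fun _ => μ) →
      Integrable (fun p : k × (Fin n → k) => f (j.insertNth (α := fun _ => k) p.1 p.2))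
        (μ.prod (Measure.pi fun _ => μ)) := fun f hf =>
    (hmp.integrable_comp_emb he).2 hf
  have hE : ∀ f : (Fin (n + 1) → k) → ℂ,
      ∫ p : k × (Fin n → k), f (j.insertNth (α := fun _ => k) p.1 p.2)
        ∂(μ.prod (Measure.pi fun _ => μ)) = ∫ u, f u ∂(Measure.pi fun _ => μ) := fun f =>
    hmp.integral_comp he f
  have h1 := hI _ (hg.comp_linearEquiv (LinearEquiv.refl k _)).1
  have h2 := hI _ (hg.comp_linearEquiv (shearEquiv j (LinearEquiv.refl k _) w)).1
  simp only [shearEquiv_insertNth, LinearEquiv.refl_apply] at h1 h2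
  rw [← hE g, integral_prod _ h1]
  have h3 := (integral_prod_symm _ h2).symm.trans (integral_prod _ h2)
  refine h3.trans (integral_congr_ae (Filter.Eventually.of_forall fun s => ?_))
  exact integral_add_right_eq_self
    (fun v : Fin n → k => g (j.insertNth (α := fun _ => k) s v)) (s • w)

end Residue

namespace SplitValuedField

variable {F Γ k : Type*} [Field F] [AddCommGroup Γ] [LinearOrder Γ] [IsOrderedAddMonoid Γ]

/-! ### Elimination of one variable by a pivot of least valuation. -/

section Matrix

open Matrix

/-- The minor left after using the `(j, r)` entry as a pivot, where the `i`-th other row has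
`w i` times the entry of the `j`-th row in column `r`. -/
def pivotMinor {n : ℕ} (M : Matrix (Fin (n + 1)) (Fin (n + 1)) F) (j r : Fin (n + 1))
    (w : Fin n → F) : Matrix (Fin n) (Fin n) F :=
  Matrix.of fun i l => M (j.succAbove i) (r.succAbove l) - w i * M j (r.succAbove l)

/-- Subtracting `w i` times row `j` from the other rows keeps the determinant and clears column `r`
off the pivot; then expand along that column. -/
theorem det_eq_pivotMinor {n : ℕ} (M : Matrix (Fin (n + 1)) (Fin (n + 1)) F) (j r : Fin (n + 1))
    (w : Fin n → F) (hw : ∀ i, M (j.succAbove i) r = w i * M j r) :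
    M.det = (-1) ^ (j + r : ℕ) * (M j r * (pivotMinor M j r w).det) := by
  let c : Fin (n + 1) → F := j.insertNth (α := fun _ => F) 0 w
  have hc : c j = 0 := Fin.insertNth_apply_same (α := fun _ => F) j 0 w
  have hc' : ∀ i, c (j.succAbove i) = w i := Fin.insertNth_apply_succAbove (α := fun _ => F) j 0 w
  let B : Matrix (Fin (n + 1)) (Fin (n + 1)) F := Matrix.of fun i l => M i l - c i * M j l
  have hdet : M.det = B.det :=
    det_eq_of_forall_row_eq_smul_add_const c j hc fun i l => by simp [B, hc]
  have hB : B.submatrix j.succAbove r.succAbove = pivotMinor M j r w := by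
    ext i l
    simp [B, hc', pivotMinor]
  have hBj : B j r = M j r := by simp [B, hc]
  rw [hdet, det_succ_column B r, Fin.sum_univ_succAbove _ j, hB, hBj, Finset.sum_eq_zero,
    add_zero, mul_assoc]
  intro i _
  have : B (j.succAbove i) r = 0 := by simp [B, hc', hw]
  rw [this, mul_zero, zero_mul]

/-- The eliminated variable `s` enters the right-hand side only through `z`: varying it moves the
point along a line of direction `w`. -/
theorem mulVec_insertNth {n : ℕ} (M : Matrix (Fin (n + 1)) (Fin (n + 1)) F) (j r : Fin (n + 1))
    (w : Fin n → F) (hw : ∀ i, M (j.succAbove i) r = w i * M j r) (b : Fin (n + 1) → F) (s : F)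
    (x : Fin n → F) (z : F) (hz : z = M j r * s + ((∑ l, M j (r.succAbove l) * x l) + b j)) :
    M *ᵥ (r.insertNth (α := fun _ => F) s x) + b = j.insertNth (α := fun _ => F) z
      (pivotMinor M j r w *ᵥ x + (fun i => b (j.succAbove i) - w i * b j) + z • w) := by
  refine funext (j.forall_iff_succAbove.2 ⟨?_, fun i => ?_⟩)
  · simp [mulVec, dotProduct, Fin.sum_univ_succAbove _ r, hz, add_assoc]
  · simp only [mulVec, dotProduct, pivotMinor, Fin.sum_univ_succAbove _ r, Pi.add_apply,
      Fin.insertNth_apply_same, Fin.insertNth_apply_succAbove, of_apply, sub_mul,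
      Finset.sum_sub_distrib, Pi.smul_apply, smul_eq_mul, mul_assoc, ← Finset.mul_sum, hz, hw]
    ring

/-- Least valuation makes the quotients by the pivot integral. A zero pivot would have valuation `⊤`
and force the whole column to vanish. -/
theorem exists_pivot [Field k] (D : SplitValuedField F Γ k) {n : ℕ}
    (M : Matrix (Fin (n + 1)) (Fin (n + 1)) F) (hM : M.det ≠ 0) (r : Fin (n + 1)) :
    ∃ (j : Fin (n + 1)) (w : Fin n → F), M j r ≠ 0 ∧ (∀ i, w i ∈ D.O) ∧
      ∀ i, M (j.succAbove i) r = w i * M j r := by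
  obtain ⟨j, hj⟩ := Finite.exists_min fun i => D.ν (M i r)
  have hne : M j r ≠ 0 := by
    intro h
    refine hM (det_eq_zero_of_column_eq_zero r fun i => ?_)
    have := hj i
    rwa [h, AddValuation.map_zero, top_le_iff, D.ν.top_iff] at this
  refine ⟨j, fun i => M (j.succAbove i) r * (M j r)⁻¹, hne, fun i => mem_O.2 ?_, fun i => ?_⟩
  · rw [← D.ν.map_one, ← mul_inv_cancel₀ hne, D.ν.map_mul, D.ν.map_mul]
    exact add_le_add_left (hj _) _
  · rw [inv_mul_cancel_right₀ hne]

end Matrix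

/-! ### Lifts to `F^n`, normalised to `O^n`. -/

section Algebra

variable [Field k] (D : SplitValuedField F Γ k) {A : Type*} [Zero A] {n : ℕ}

theorem tF_neg_zero : D.tF (-0) = 1 := by
  simp [tF]

/-- Moves centre and radii into the argument, so that the induction only meets lifts with `a = 0`
and `γ = 0`. -/
theorem liftN_eq_liftN_zero (g : (Fin n → k) → A) (a : Fin n → F) (γ : Fin n → Γ)
    (x y : Fin n → F) (h : ∀ i, y i = (x i - a i) * D.tF (-γ i)) :
    D.liftN g a γ x = D.liftN g 0 0 y := by
  have h' : (fun i => (x i - a i) * D.tF (-γ i)) =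
      fun i => (y i - (0 : Fin n → F) i) * D.tF (-(0 : Fin n → Γ) i) := by
    funext i
    rw [Pi.zero_apply, Pi.zero_apply, tF_neg_zero, sub_zero, mul_one, h]
  let G : (Fin n → F) → A := fun z =>
    open Classical in if ∀ i, z i ∈ D.O then g (fun i => D.res (z i)) else 0
  exact congrArg G h'

theorem liftN_zero_of_mem (g : (Fin n → k) → A) {x : Fin n → F} (hx : ∀ i, x i ∈ D.O) :
    D.liftN g 0 0 x = g (fun i => D.res (x i)) := by
  have h : ∀ i, (x i - (0 : Fin n → F) i) * D.tF (-(0 : Fin n → Γ) i) = x i := fun i => by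
    rw [Pi.zero_apply, Pi.zero_apply, tF_neg_zero, sub_zero, mul_one]
  rw [liftN, if_pos fun i => (h i).symm ▸ hx i]
  simp only [h]

theorem liftN_zero_of_not_mem (g : (Fin n → k) → A) {x : Fin n → F} (hx : ¬ ∀ i, x i ∈ D.O) :
    D.liftN g 0 0 x = 0 := by
  have h : ∀ i, (x i - (0 : Fin n → F) i) * D.tF (-(0 : Fin n → Γ) i) = x i := fun i => by
    rw [Pi.zero_apply, Pi.zero_apply, tF_neg_zero, sub_zero, mul_one]
  rw [liftN, if_neg fun h' => hx fun i => h i ▸ h' i]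

theorem lift_zero_of_mem (g : k → A) {x : F} (hx : x ∈ D.O) : D.lift g 0 0 x = g (D.res x) := by
  have h : (x - 0) * D.tF (-0) = x := by rw [tF_neg_zero, sub_zero, mul_one]
  rw [lift, if_pos (h.symm ▸ hx), h]

theorem lift_zero_of_not_mem (g : k → A) {x : F} (hx : x ∉ D.O) : D.lift g 0 0 x = 0 := by
  have h : (x - 0) * D.tF (-0) = x := by rw [tF_neg_zero, sub_zero, mul_one]
  rw [lift, if_neg fun h' => hx (h ▸ h')]

/-- For `z ∈ O` the terms `z * w i` are integral, so `y + z • w` is integral exactly when `y` is,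
and its residue lies on the line through `res y` of direction `res w`. Otherwise both sides vanish.
-/
theorem liftN_insertNth (g : (Fin (n + 1) → k) → A) (j : Fin (n + 1)) (w : Fin n → F)
    (hw : ∀ i, w i ∈ D.O) (z : F) (y : Fin n → F) :
    D.liftN g 0 0 (j.insertNth (α := fun _ => F) z (y + z • w)) =
      D.lift (fun s => D.liftN
        (fun v => g (j.insertNth (α := fun _ => k) s (v + s • fun i => D.res (w i)))) 0 0 y)
        0 0 z := by
  set x := j.insertNth (α := fun _ => F) z (y + z • w) with hx
  have hxj : x j = z := Fin.insertNth_apply_same (α := fun _ => F) j z _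
  have hxi : ∀ i, x (j.succAbove i) = y i + z * w i :=
    Fin.insertNth_apply_succAbove (α := fun _ => F) j z _
  by_cases hz : z ∈ D.O
  · have hiff : ∀ i, y i + z * w i ∈ D.O ↔ y i ∈ D.O := fun i =>
      add_mem_cancel_right (mul_mem hz (hw i))
    have hall : (∀ i, x i ∈ D.O) ↔ ∀ i, y i ∈ D.O := by
      simp only [j.forall_iff_succAbove, hxj, hxi, hz, hiff, true_and]
    rw [D.lift_zero_of_mem _ hz]
    by_cases hy : ∀ i, y i ∈ D.O
    · rw [D.liftN_zero_of_mem _ hy, D.liftN_zero_of_mem _ (hall.2 hy)]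
      congr 1
      refine funext (j.forall_iff_succAbove.2 ⟨by simp [hxj], fun i => ?_⟩)
      simp only [Fin.insertNth_apply_succAbove, Pi.add_apply, Pi.smul_apply, smul_eq_mul, hxi]
      rw [res_add (hy i) (mul_mem hz (hw i)), res_mul hz (hw i)]
    · rw [D.liftN_zero_of_not_mem _ hy, D.liftN_zero_of_not_mem _ (hall.not.2 hy)]
  · rw [D.lift_zero_of_not_mem _ hz, D.liftN_zero_of_not_mem _ fun h => hz (hxj ▸ h j)]

theorem det_diagonal_tF (γ : Fin n → Γ) :
    (Matrix.diagonal fun i => D.tF (-γ i)).det =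
      ((∏ i, D.t (Multiplicative.ofAdd (-γ i)) : Fˣ) : F) := by
  rw [Matrix.det_diagonal, Units.coe_prod]
  rfl

end Algebra

/-! ### Repeated integrals of affine pullbacks of lifts. -/

section Integral

variable [NontriviallyNormedField k] [MeasurableSpace k] (D : SplitValuedField F Γ k)
  (μ : Measure k)

theorem integral_liftN {n : ℕ} (φ : k → (Fin n → k) → ℂ) (y : Fin n → F) :
    ∫ s, D.liftN (φ s) 0 0 y ∂μ = D.liftN (fun v => ∫ s, φ s v ∂μ) 0 0 y := by
  by_cases hy : ∀ i, y i ∈ D.O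
  · simp only [D.liftN_zero_of_mem _ hy]
  · simp only [D.liftN_zero_of_not_mem _ hy, MeasureTheory.integral_zero]

theorem integrable_liftN {n : ℕ} {φ : k → (Fin n → k) → ℂ}
    (hφ : ∀ v, Integrable (fun s => φ s v) μ) (y : Fin n → F) :
    Integrable (fun s => D.liftN (φ s) 0 0 y) μ := by
  by_cases hy : ∀ i, y i ∈ D.O
  · simpa only [D.liftN_zero_of_mem _ hy] using hφ _
  · simp only [D.liftN_zero_of_not_mem _ hy]
    exact integrable_zero _ _ _

variable [LocallyCompactSpace k] [BorelSpace k] [μ.IsAddHaarMeasure]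

/-- A section of the affine pullback of a lift, and its integral. -/
theorem section_liftN_affine {n : ℕ} {g : (Fin (n + 1) → k) → ℂ} (hg : IsGLFubini μ (n + 1) g)
    (M : Matrix (Fin (n + 1)) (Fin (n + 1)) F) (j r : Fin (n + 1)) (w : Fin n → F) (α : Fˣ)
    (hα : (α : F) = M j r) (hwO : ∀ i, w i ∈ D.O) (hw : ∀ i, M (j.succAbove i) r = w i * M j r)
    (b : Fin (n + 1) → F) (x : Fin n → F) :
    (fun s => ofC Γ (D.liftN g 0 0 (M.mulVec (r.insertNth (α := fun _ => F) s x) + b))) ∈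
        D.integrableFunctions μ ∧
      D.integral μ
        (fun s => ofC Γ (D.liftN g 0 0 (M.mulVec (r.insertNth (α := fun _ => F) s x) + b))) =
        (D.absF α)⁻¹ * ofC Γ (D.liftN (lineIntegral μ j (fun i => D.res (w i)) g) 0 0
          ((pivotMinor M j r w).mulVec x + fun i => b (j.succAbove i) - w i * b j)) := by
  simp only [mulVec_insertNth M j r w hw b _ x _ rfl, liftN_insertNth D g j w hwO, ← hα]
  -- The section is now a one-variable lift composed with `s ↦ α s + const`; this is integrability
  -- of the function being lifted.
  have hφ := D.integrable_liftN μ (fun v => hg.integrable_line j (fun i => D.res (w i)) v)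
    ((pivotMinor M j r w).mulVec x + fun i => b (j.succAbove i) - w i * b j)
  refine ⟨D.lift_affine_mem μ hφ α _, ?_⟩
  rw [D.integral_lift_affine μ hφ, integral_liftN]
  rfl

/-- Allowing all invertible affine maps and all GL-Fubini `g` closes the induction: a partial
integral is a constant times a function of the same kind, with `pivotMinor` and `lineIntegral` in
place of `M` and `g`. -/
theorem isFubini_liftN_affine {n : ℕ} {g : (Fin n → k) → ℂ} (hg : IsGLFubini μ n g)
    (M : Matrix (Fin n) (Fin n) F) (b : Fin n → F) (d : Fˣ) (hd : M.det = d) :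
    D.IsFubini μ n (fun x => ofC Γ (D.liftN g 0 0 (M.mulVec x + b))) ∧
      D.repeatedIntegral μ n (fun x => ofC Γ (D.liftN g 0 0 (M.mulVec x + b))) =
        (D.absF d)⁻¹ * ofC Γ (∫ u, g u ∂(Measure.pi fun _ => μ)) := by
  induction n generalizing d with
  | zero =>
    -- In dimension 0 the determinant is 1 and the product measure is a Dirac mass.
    have hd1 : d = 1 := Units.ext (by rw [← hd, Matrix.det_fin_zero, Units.val_one])
    refine ⟨trivial, ?_⟩
    have hu : ∀ v : Fin 0 → k, g v = g Fin.elim0 := fun v => congrArg g (Subsingleton.elim _ _)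
    rw [hd1, absF_one, inv_one, one_mul, repeatedIntegral,
      D.liftN_zero_of_mem g fun i => i.elim0, hu, integral_congr_ae (Filter.Eventually.of_forall hu),
      Measure.pi_of_empty, integral_dirac]
  | succ n ih =>
    have key : ∀ r : Fin (n + 1),
        (∀ x, (fun s => ofC Γ (D.liftN g 0 0
          (M.mulVec (r.insertNth (α := fun _ => F) s x) + b))) ∈ D.integrableFunctions μ) ∧
        D.IsFubini μ n (D.partialIntegral μ r
          fun x => ofC Γ (D.liftN g 0 0 (M.mulVec x + b))) ∧
        D.repeatedIntegral μ n (D.partialIntegral μ r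
          fun x => ofC Γ (D.liftN g 0 0 (M.mulVec x + b))) =
          (D.absF d)⁻¹ * ofC Γ (∫ u, g u ∂(Measure.pi fun _ => μ)) := by
      intro r
      obtain ⟨j, w, hne, hwO, hw⟩ := exists_pivot D M (hd ▸ d.ne_zero) r
      have hsec := D.section_liftN_affine μ hg M j r w (Units.mk0 _ hne) rfl hwO hw b
      have hdet := det_eq_pivotMinor M j r w hw
      have hne' : (pivotMinor M j r w).det ≠ 0 := by
        intro h
        rw [h, mul_zero, mul_zero, hd] at hdet
        exact d.ne_zero hdet
      have hd' : d = (-1) ^ (j + r : ℕ) * (Units.mk0 _ hne * Units.mk0 _ hne') :=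
        Units.ext (by simpa [← hd] using hdet)
      obtain ⟨hF, hR⟩ := ih (hg.lineIntegral j fun i => D.res (w i)) (pivotMinor M j r w)
        (fun i => b (j.succAbove i) - w i * b j) (Units.mk0 _ hne') rfl
      have hP := funext fun x => (hsec x).2
      refine ⟨fun x => (hsec x).1, ?_⟩
      unfold partialIntegral
      rw [hP]
      refine ⟨hF.smul _, ?_⟩
      rw [repeatedIntegral_smul _ hF, hR, integral_lineIntegral hg, hd', absF_neg_one_pow_mul,
        absF_mul, mul_inv, mul_assoc]
    -- The value found in `key` is free of `r`, which gives independence of the order.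
    exact ⟨⟨fun r => (key r).1, fun r => (key r).2.1,
      fun r r' => (key r).2.2.trans (key r').2.2.symm⟩, (key 0).2.2⟩

/-- The value involves neither `a` nor `c`, and `τ` only through its determinant; both
change-of-variables formulas are read off from this. -/
theorem isFubini_liftN {n : ℕ} {g : (Fin n → k) → ℂ} (hg : IsGLFubini μ n g)
    (a : Fin n → F) (γ : Fin n → Γ) (τ : Matrix.GeneralLinearGroup (Fin n) F) (c : Fin n → F) :
    D.IsFubini μ n (fun x => ofC Γ (D.liftN g a γ (τ.1.mulVec (x + c)))) ∧
      D.repeatedIntegral μ n (fun x => ofC Γ (D.liftN g a γ (τ.1.mulVec (x + c)))) =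
        (D.absF ((∏ i, D.t (Multiplicative.ofAdd (-γ i))) *
          Matrix.GeneralLinearGroup.det τ))⁻¹ * ofC Γ (∫ u, g u ∂(Measure.pi fun _ => μ)) := by
  have h : ∀ x, D.liftN g a γ (τ.1.mulVec (x + c)) = D.liftN g 0 0
      (((Matrix.diagonal fun i => D.tF (-γ i)) * τ.1).mulVec x +
        fun i => (τ.1.mulVec c i - a i) * D.tF (-γ i)) := by
    refine fun x => D.liftN_eq_liftN_zero g a γ _ _ fun i => ?_
    rw [Pi.add_apply, ← Matrix.mulVec_mulVec, Matrix.mulVec_diagonal, Matrix.mulVec_add,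
      Pi.add_apply]
    ring
  simp only [h]
  refine D.isFubini_liftN_affine μ hg _ _ _ ?_
  rw [Matrix.det_mul, det_diagonal_tF, Units.val_mul]
  rfl

end Integral

/-! ### Extension from the generators to the span. -/

section SpaceGL

variable [NontriviallyNormedField k] [MeasurableSpace k]

/-- Translates and pullbacks of the generators. -/
theorem liftN_comp_mem_spaceGL (D : SplitValuedField F Γ k) (μ : Measure k) {n : ℕ}
    {g : (Fin n → k) → ℂ} (hg : IsGLFubini μ n g) (a : Fin n → F) (γ : Fin n → Γ)
    (τ : Matrix.GeneralLinearGroup (Fin n) F) (c : Fin n → F) :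
    (fun x => ofC Γ (D.liftN g a γ (τ.1.mulVec (x + c)))) ∈ D.spaceGL μ n := by
  refine Submodule.subset_span ⟨g, τ, a - τ.1.mulVec c, γ, hg, funext fun x => ?_⟩
  rw [D.liftN_eq_liftN_zero g _ γ (τ.1.mulVec x) _ fun i => rfl,
    D.liftN_eq_liftN_zero g a γ _ _ fun i => ?_]
  rw [Matrix.mulVec_add, Pi.add_apply, Pi.sub_apply, sub_sub_eq_add_sub]

variable [LocallyCompactSpace k] [BorelSpace k]

theorem isFubini_of_mem_spaceGL (D : SplitValuedField F Γ k) (μ : Measure k)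
    [μ.IsAddHaarMeasure] {n : ℕ} {f : (Fin n → F) → CC Γ} (hf : f ∈ D.spaceGL μ n) :
    D.IsFubini μ n f := by
  induction hf using Submodule.span_induction with
  | mem f hf =>
    obtain ⟨g, τ, a, γ, hg, rfl⟩ := hf
    simpa using (D.isFubini_liftN μ hg a γ τ 0).1
  | zero => exact D.isFubini_zero μ n
  | add f g _ _ hf hg => exact hf.add hg
  | smul c f _ hf => exact hf.smul c

/-- To compare integrals of `f` and of `f ∘ φ` on the space `L(F^n, GL_n)`, it is enough to do so
for the generators. -/
theorem spaceGL_comp (D : SplitValuedField F Γ k) (μ : Measure k) [μ.IsAddHaarMeasure] {n : ℕ}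
    (φ : (Fin n → F) → (Fin n → F)) (m : CC Γ)
    (h : ∀ (g : (Fin n → k) → ℂ) (τ : Matrix.GeneralLinearGroup (Fin n) F) (a : Fin n → F)
      (γ : Fin n → Γ), IsGLFubini μ n g →
      (fun x => ofC Γ (D.liftN g a γ (τ.1.mulVec (φ x)))) ∈ D.spaceGL μ n ∧
      D.repeatedIntegral μ n (fun x => ofC Γ (D.liftN g a γ (τ.1.mulVec (φ x)))) =
        m * D.repeatedIntegral μ n (fun x => ofC Γ (D.liftN g a γ (τ.1.mulVec x))))
    {f : (Fin n → F) → CC Γ} (hf : f ∈ D.spaceGL μ n) :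
    (fun x => f (φ x)) ∈ D.spaceGL μ n ∧
      D.repeatedIntegral μ n (fun x => f (φ x)) = m * D.repeatedIntegral μ n f := by
  induction hf using Submodule.span_induction with
  | mem f hf =>
    obtain ⟨g, τ, a, γ, hg, rfl⟩ := hf
    exact h g τ a γ hg
  | zero =>
    refine ⟨zero_mem _, ?_⟩
    have h0 : D.repeatedIntegral μ n 0 = 0 := D.repeatedIntegral_zero μ n
    rw [h0, mul_zero]
    exact h0
  | add f g hf hg ihf ihg =>
    refine ⟨add_mem ihf.1 ihg.1, ?_⟩
    -- Additivity holds for Fubini functions, so membership of both `f` and `f ∘ φ` in the space is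
    -- needed.
    have h1 := repeatedIntegral_add (D.isFubini_of_mem_spaceGL μ ihf.1)
      (D.isFubini_of_mem_spaceGL μ ihg.1)
    have h2 := repeatedIntegral_add (D.isFubini_of_mem_spaceGL μ hf)
      (D.isFubini_of_mem_spaceGL μ hg)
    rw [ihf.2, ihg.2, ← mul_add, ← h2] at h1
    exact h1
  | smul c f hf ihf =>
    refine ⟨Submodule.smul_mem _ c ihf.1, ?_⟩
    have h1 := repeatedIntegral_smul c (D.isFubini_of_mem_spaceGL μ ihf.1)
    have h2 := repeatedIntegral_smul c (D.isFubini_of_mem_spaceGL μ hf)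
    rw [ihf.2, mul_left_comm, ← h2] at h1
    exact h1

end SpaceGL

end SplitValuedField

end ResidueIntegration

end

theorem theorem3p1 {F Γ k : Type*} [Field F] [AddCommGroup Γ] [LinearOrder Γ]
    [IsOrderedAddMonoid Γ] [NontriviallyNormedField k] [LocallyCompactSpace k]
    [MeasurableSpace k] [BorelSpace k] (μ : Measure k) [μ.IsAddHaarMeasure]
    (D : ResidueIntegration.SplitValuedField F Γ k) (n : ℕ) :
    (∀ f ∈ D.spaceGL μ n, D.IsFubini μ n f) ∧
    (∀ f ∈ D.spaceGL μ n, ∀ a : Fin n → F,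
      (fun x => f (x + a)) ∈ D.spaceGL μ n ∧
      D.repeatedIntegral μ n (fun x => f (x + a)) = D.repeatedIntegral μ n f) ∧
    (∀ f ∈ D.spaceGL μ n, ∀ τ : Matrix.GeneralLinearGroup (Fin n) F,
      (fun x => f (τ.1.mulVec x)) ∈ D.spaceGL μ n ∧
      D.repeatedIntegral μ n (fun x => f (τ.1.mulVec x)) =
        (D.absF (Matrix.GeneralLinearGroup.det τ))⁻¹ * D.repeatedIntegral μ n f) := by
  refine ⟨fun f hf => D.isFubini_of_mem_spaceGL μ hf, fun f hf a => ?_, fun f hf τ => ?_⟩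
  · rw [← one_mul (D.repeatedIntegral μ n f)]
    refine D.spaceGL_comp μ (· + a) 1 (fun g σ b γ hg => ?_) hf
    refine ⟨D.liftN_comp_mem_spaceGL μ hg b γ σ a, ?_⟩
    have h0 := (D.isFubini_liftN μ hg b γ σ 0).2
    simp only [add_zero] at h0
    rw [one_mul, h0, (D.isFubini_liftN μ hg b γ σ a).2]
  · refine D.spaceGL_comp μ (τ.1.mulVec ·) _ (fun g σ b γ hg => ?_) hf
    -- Composing with `τ` replaces `σ` by `σ * τ` in the generator; multiplicativity of `det` and
    -- `absF` isolates the factor `|det τ|⁻¹`.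
    have hmul : ∀ x, σ.1.mulVec (τ.1.mulVec x) = (σ * τ).1.mulVec x := fun x =>
      Matrix.mulVec_mulVec _ _ _
    have h0 := (D.isFubini_liftN μ hg b γ σ 0).2
    have h1 := (D.isFubini_liftN μ hg b γ (σ * τ) 0).2
    have h2 := D.liftN_comp_mem_spaceGL μ hg b γ (σ * τ) 0
    simp only [add_zero] at h0 h1 h2
    simp only [hmul]
    refine ⟨h2, ?_⟩
    rw [h0, h1, map_mul, ← mul_assoc, D.absF_mul, mul_inv, mul_comm (D.absF _)⁻¹, mul_assoc]
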